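/- Fix real numbers $0<q<1$ and $0<\delta<1$, and for $k\ge 0$ let $$\phi_k(x;1)=\prod_{j=0}^{k-1}\bigl(1-2xq^j+q^{2j}\bigr).$$ For an entire function $f$ put $M(r;f)=\max_{|x|=r}|f(x)|$ and let $$\sigma_{\log}=\limsup_{r\to\infty}\frac{\ln^+\ln^+M(r;f)}{\ln\ln r}$$ be its log-order. For $n,N\ge 0$ and $\gamma>1$ define $$\alpha(t)=-\tfrac1\delta t^\delta,\qquad \alpha_n=\exp\Bigl(\int_0^n\alpha(t)\,dt\Bigr),\qquad \rho_n=e^{-\alpha(n)},\qquad \varepsilon_{n,N}=\sum_{k=n}^{N-1}\frac{2q^{-k}}{e^{N^\gamma}}.$$ Given complex numbers $a_0,a_1,\dots$, say that the terms $a_n\phi_n(x;1)$ are dominated at a point $x$ if there is $N\ge 0$ such that for every $n\ge 0$ $$|a_n\phi_n(x;1)|\le|a_N\phi_N(x;1)|\,\frac{\alpha_n}{\alpha_N}\,\rho_N^{\,n-N}\quad\text{if } n\ge N,$$ $$|a_n\phi_n(x;1)|\le|a_N\phi_N(x;1)|\,(1+\varepsilon_{n,N})\,\frac{\alpha_n}{\alpha_N}\,\rho_N^{\,n-N}\quad\text{if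 } n<N.$$ A radius $r>0$ is called $q$-normal if the terms are dominated at $x=r$, and $q$-exceptional otherwise. **Theorem 5.3.** Let $f$ be a non-constant entire function of log-order $\sigma_{\log}<2$ and let $\gamma\in\bigl(1,\frac1{\sigma_{\log}-1}\bigr)$, where $\frac1{\sigma_{\log}-1}=\infty$ if $\sigma_{\log}=1$. Then there is a unique sequence $(a_n)_{n\ge0}$ of complex numbers such that $\sum_{k\ge0}a_k\phi_k(x;1)$ converges to $f$ uniformly on compact subsets of $\mathbb{C}$, and for this sequence the set $$E=\{r\in[1,\infty): r\text{ is } q\text{-exceptional}\}$$ has zero logarithmic density, that is, $$\limsup_{r\to\infty}\frac1{\ln r}\int_{E\cap[1,r]}\frac{dx}{x}=0.$$ The same holds for the set of those $r\in[1,\infty)$ for which the terms are not dominated at $x=-r$. -/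

import Mathlib

open Filter Topology MeasureTheory
open scoped ENNReal

namespace AskeyWilson

/-- The maximum modulus `M(r; f) = max {|f x| : |x| = r}`. -/
noncomputable def maxModulus (f : ℂ → ℂ) (r : ℝ) : ℝ :=
  sSup ((fun x => ‖f x‖) '' Metric.sphere (0 : ℂ) r)

/-- The logarithmic order `limsup_{r → ∞} ln⁺ ln⁺ M(r; f) / ln ln r`, in the extended reals. -/
noncomputable def logOrder (f : ℂ → ℂ) : EReal :=
  limsup (fun r : ℝ =>
    ((Real.posLog (Real.posLog (maxModulus f r)) / Real.log (Real.log r) : ℝ) : EReal)) atTop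

/-- The Askey-Wilson basis polynomial at the point `1`:
`φ_k(x; 1) = (z, 1/z; q)_k = ∏_{j < k} (1 - 2 x q^j + q^{2j})`, where `x = (z + 1/z) / 2`. -/
noncomputable def phi (q : ℝ) (k : ℕ) (x : ℂ) : ℂ :=
  ∏ j ∈ Finset.range k, (1 - 2 * x * (q : ℂ) ^ j + (q : ℂ) ^ (2 * j))

/-- `∑ a_k φ_k(x; 1)` is an Askey-Wilson series expansion of `f`: its partial sums converge to `f`
uniformly on compact subsets of the plane. -/
def IsExpansion (q : ℝ) (a : ℕ → ℂ) (f : ℂ → ℂ) : Prop :=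
  TendstoLocallyUniformly (fun n x => ∑ k ∈ Finset.range n, a k * phi q k x) f atTop

/-- The function `α(t) = -t^δ / δ`. -/
noncomputable def alphaFun (δ t : ℝ) : ℝ := -(1 / δ) * t ^ δ

/-- The comparison sequence `α_n = exp (∫_0^n α(t) dt)`. -/
noncomputable def alphaSeq (δ : ℝ) (n : ℕ) : ℝ :=
  Real.exp (∫ t in (0 : ℝ)..(n : ℝ), alphaFun δ t)

/-- The comparison sequence `ρ_n = exp (-α(n))`. -/
noncomputable def rhoSeq (δ : ℝ) (n : ℕ) : ℝ := Real.exp (-alphaFun δ n)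

/-- `ε_{n,N} = ∑_{n ≤ k < N} 2 q^{-k} / exp (N^γ)`. -/
noncomputable def eps (q γ : ℝ) (n N : ℕ) : ℝ :=
  ∑ k ∈ Finset.Ico n N, 2 * (q ^ k)⁻¹ / Real.exp ((N : ℝ) ^ γ)

/-- At the point `x`, the terms `a_n φ_n(x; 1)` are dominated by the comparison sequences
relative to some central term `a_N φ_N(x; 1)`. -/
def IsDominatedAt (q γ δ : ℝ) (a : ℕ → ℂ) (x : ℂ) : Prop :=
  ∃ N : ℕ, ∀ n : ℕ,
    (N ≤ n → ‖a n * phi q n x‖ ≤ ‖a N * phi q N x‖ *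
      (alphaSeq δ n / alphaSeq δ N) * rhoSeq δ N ^ ((n : ℤ) - (N : ℤ))) ∧
    (n < N → ‖a n * phi q n x‖ ≤ ‖a N * phi q N x‖ * (1 + eps q γ n N) *
      (alphaSeq δ n / alphaSeq δ N) * rhoSeq δ N ^ ((n : ℤ) - (N : ℤ)))

/-- The radius `r` is `q`-normal, the terms being evaluated at `x = r`. -/
def IsQNormal (q γ δ : ℝ) (a : ℕ → ℂ) (r : ℝ) : Prop :=
  0 < r ∧ IsDominatedAt q γ δ a (r : ℂ)

/-- The variant of `q`-normality in which the terms are evaluated at `x = -r`, the point of the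
circle `|x| = r` at which every `|φ_n(x; 1)|` is maximal. -/
def IsQNormalNeg (q γ δ : ℝ) (a : ℕ → ℂ) (r : ℝ) : Prop :=
  0 < r ∧ IsDominatedAt q γ δ a (-(r : ℂ))

/-- The set of `q`-exceptional radii `r ≥ 1`. -/
def exceptionalSet (q γ δ : ℝ) (a : ℕ → ℂ) : Set ℝ :=
  {r | 1 ≤ r ∧ ¬ IsQNormal q γ δ a r}

/-- The set of radii `r ≥ 1` that are exceptional for the terms evaluated at `x = -r`. -/
def exceptionalSetNeg (q γ δ : ℝ) (a : ℕ → ℂ) : Set ℝ :=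
  {r | 1 ≤ r ∧ ¬ IsQNormalNeg q γ δ a r}

/-- The logarithmic measure `∫_E dx / x`. -/
noncomputable def logMeas (E : Set ℝ) : ℝ≥0∞ := ∫⁻ x in E, ENNReal.ofReal (1 / x)

/-- The (upper) logarithmic density `limsup_{r → ∞} logmeas (E ∩ [1, r]) / ln r`. -/
noncomputable def logDensity (E : Set ℝ) : ℝ≥0∞ :=
  limsup (fun r : ℝ => logMeas (E ∩ Set.Icc 1 r) / ENNReal.ofReal (Real.log r)) atTop

end AskeyWilson

/-! Up to its leading coefficient, `phi q k` is the Newton polynomial with nodes `node q j`. The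
expansion is therefore Newton interpolation. Log-order below two makes ln M(r) = o(ln² r), so the
monic coefficients, of modulus c_n = `‖a n * leadCoeff q n‖`, decay faster than every Gaussian
(`exists_isExpansion`). This also sends the remainder to zero. Evaluation at the nodes gives a
triangular system, hence uniqueness.

For domination, take K = ln(2/q) + 1/δ and let N = N(s) maximize c_n exp(Kn² + ns). Evaluate at any
x with |x| = exp(s + 2KN). Maximality bounds c_n/c_N, and `prod_node_le` bounds the ratio of the
node products by |x|^(n-N) exp(ln(2/q)(n-N)²). Completing the square leaves exp(-(n-N)²/δ), which is
at most the prescribed comparison factor (`le_alphaSeq_div_mul`). Only |x| enters, so x = r and x =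
-r are treated alike.

The good radii thus include exp(s + d(s)) with d = 2KN(s). Since N is monotone and o(s)
(`exists_centralIndex`), s ↦ s + d(s) does not contract distances, and its image omits only a set of
density zero (`logDensity_eq_zero`). -/

namespace AskeyWilson

/-! ### Newton interpolation and divided differences -/

/-- The iterated divided differences `z ↦ f[x_0, …, x_{n-1}, z]`. -/
noncomputable def divDiff (f : ℂ → ℂ) (x : ℕ → ℂ) : ℕ → ℂ → ℂ
  | 0 => f
  | n + 1 => dslope (divDiff f x n) (x n)

theorem differentiable_divDiff {f : ℂ → ℂ} (hf : Differentiable ℂ f) (x : ℕ → ℂ) (n : ℕ) :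
    Differentiable ℂ (divDiff f x n) := by
  induction n with
  | zero => exact hf
  | succ n ih =>
    rw [← differentiableOn_univ] at ih ⊢
    exact (Complex.differentiableOn_dslope univ_mem).2 ih

/-- Newton's interpolation formula with remainder. -/
theorem newton_formula (f : ℂ → ℂ) (x : ℕ → ℂ) (n : ℕ) (z : ℂ) :
    f z = ∑ k ∈ Finset.range n, divDiff f x k (x k) * ∏ j ∈ Finset.range k, (z - x j) +
      (∏ j ∈ Finset.range n, (z - x j)) * divDiff f x n z := by
  induction n with
  | zero => simp [divDiff]
  | succ n ih =>
    have h := sub_smul_dslope (divDiff f x n) (x n) z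
    rw [smul_eq_mul] at h
    rw [Finset.sum_range_succ, Finset.prod_range_succ, divDiff, mul_assoc, h, ih]
    ring

theorem norm_le_of_sphere {g : ℂ → ℂ} (hg : Differentiable ℂ g) {R B : ℝ} (hR : 0 < R)
    (h : ∀ z, ‖z‖ = R → ‖g z‖ ≤ B) {z : ℂ} (hz : ‖z‖ ≤ R) : ‖g z‖ ≤ B := by
  refine Complex.norm_le_of_forall_mem_frontier_norm_le (U := Metric.ball 0 R)
    Metric.isBounded_ball hg.diffContOnCl (fun w hw => h w ?_) ?_
  · rw [frontier_ball _ hR.ne'] at hw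
    simpa using hw
  · rw [closure_ball _ hR.ne']
    simpa using hz

/-- On |w| = R every node is at distance at least R/2, so each difference quotient costs a factor
2/(R/2) = 4/R. The maximum principle carries the bound into the disc. -/
theorem norm_divDiff_le {f : ℂ → ℂ} (hf : Differentiable ℂ f) (x : ℕ → ℂ) {R B : ℝ}
    (hR : 0 < R) (hB : ∀ z, ‖z‖ = R → ‖f z‖ ≤ B) (n : ℕ) (hx : ∀ j < n, 2 * ‖x j‖ ≤ R)
    {z : ℂ} (hz : ‖z‖ ≤ R) : ‖divDiff f x n z‖ ≤ (4 / R) ^ n * B := by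
  induction n generalizing z with
  | zero => simpa [divDiff] using norm_le_of_sphere hf hR hB hz
  | succ n ih =>
    have ih' := fun {z : ℂ} => ih (fun j hj => hx j (hj.trans n.lt_succ_self)) (z := z)
    have hxn := hx n n.lt_succ_self
    refine norm_le_of_sphere (differentiable_divDiff hf x (n + 1)) hR (fun w hw => ?_) hz
    have h := sub_smul_dslope (divDiff f x n) (x n) w
    have h1 : R / 2 ≤ ‖w - x n‖ := by
      have := norm_sub_norm_le w (x n)
      linarith
    have h2 : ‖w - x n‖ * ‖divDiff f x (n + 1) w‖ ≤ 2 * ((4 / R) ^ n * B) := by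
      rw [divDiff, ← norm_smul, h]
      refine (norm_sub_le _ _).trans ?_
      have := ih' (z := w) hw.le
      have := ih' (z := x n) (by linarith [norm_nonneg (x n)])
      linarith
    have h3 := mul_le_mul_of_nonneg_right h1 (norm_nonneg (divDiff f x (n + 1) w))
    have h4 : ‖divDiff f x (n + 1) w‖ ≤ 2 * ((4 / R) ^ n * B) / (R / 2) := by
      rw [le_div_iff₀ (by positivity)]
      linarith
    refine h4.trans (le_of_eq ?_)
    rw [pow_succ]
    field_simp
    ring

/-! ### Growth of the maximum modulus -/

theorem norm_le_maxModulus {f : ℂ → ℂ} (hf : Continuous f) (z : ℂ) :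
    ‖f z‖ ≤ maxModulus f ‖z‖ := by
  refine le_csSup ?_ ⟨z, by simp, rfl⟩
  exact ((isCompact_sphere (0 : ℂ) ‖z‖).image hf.norm).bddAbove

theorem le_exp_posLog (y : ℝ) : y ≤ Real.exp (Real.posLog y) := by
  rcases le_or_gt y 0 with h | h
  · exact h.trans (Real.exp_pos _).le
  · exact (Real.le_exp_log y).trans (Real.exp_le_exp.2 (le_max_right _ _))

/-- A function of logarithmic order less than two satisfies `ln M(r) = o(ln² r)`. -/
theorem eventually_maxModulus_le {f : ℂ → ℂ} (hσ : logOrder f < 2) {ε : ℝ} (hε : 0 < ε) :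
    ∀ᶠ r in atTop, maxModulus f r ≤ Real.exp (ε * Real.log r ^ 2) := by
  obtain ⟨σ, h1, h2⟩ := EReal.lt_iff_exists_real_btwn.1 hσ
  have hσ2 : σ < 2 := EReal.coe_lt_coe_iff.1 h2
  have h3 := eventually_lt_of_limsup_lt h1
  have h4 : ∀ᶠ y : ℝ in atTop, y ^ σ ≤ ε * y ^ 2 := by
    filter_upwards [(tendsto_rpow_neg_atTop (sub_pos.2 hσ2)).eventually_lt_const hε,
      eventually_gt_atTop 0] with y hy hy0
    rw [neg_sub, Real.rpow_sub hy0, Real.rpow_two, div_lt_iff₀ (by positivity)] at hy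
    exact hy.le
  have h5 := Real.tendsto_log_atTop
  filter_upwards [h3, h5.eventually h4, h5.eventually (eventually_gt_atTop 1)] with r hr hr4 hr1
  have hll := Real.log_pos hr1
  have hr' : Real.posLog (Real.posLog (maxModulus f r)) / Real.log (Real.log r) < σ := by
    exact_mod_cast hr
  rw [div_lt_iff₀ hll] at hr'
  refine (le_exp_posLog _).trans (Real.exp_le_exp.2 ?_)
  refine (le_exp_posLog _).trans (le_trans ?_ hr4)
  rw [Real.rpow_def_of_pos (by linarith), mul_comm (Real.log (Real.log r))]
  exact Real.exp_le_exp.2 hr'.le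

/-! ### Nodes of the basis and uniqueness of the expansion -/

/-- The zeros `(q^j + q^{-j}) / 2` of the basis polynomials. -/
noncomputable def node (q : ℝ) (j : ℕ) : ℝ := (q ^ j + (q ^ j)⁻¹) / 2

theorem node_nonneg {q : ℝ} (hq0 : 0 < q) (j : ℕ) : 0 ≤ node q j := by
  unfold node; positivity

theorem node_le {q : ℝ} (hq0 : 0 < q) (hq1 : q < 1) (j : ℕ) : node q j ≤ (q ^ j)⁻¹ := by
  have h1 : q ^ j ≤ 1 := pow_le_one₀ hq0.le hq1.le
  have h2 := (one_le_inv₀ (pow_pos hq0 j)).2 h1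
  unfold node
  linarith

theorem inv_pow_le {q : ℝ} (hq0 : 0 < q) (hq1 : q < 1) {j n : ℕ} (h : j ≤ n) :
    (q ^ j)⁻¹ ≤ (q ^ n)⁻¹ :=
  inv_anti₀ (pow_pos hq0 n) (pow_le_pow_of_le_one hq0.le hq1.le h)

theorem norm_node {q : ℝ} (hq0 : 0 < q) (j : ℕ) : ‖(node q j : ℂ)‖ = node q j := by
  rw [Complex.norm_real, Real.norm_of_nonneg (node_nonneg hq0 j)]

/-- The leading coefficient `∏_{j < n} (-2 q^j)` of `phi q n`. -/
noncomputable def leadCoeff (q : ℝ) (n : ℕ) : ℂ := ∏ j ∈ Finset.range n, (-2 * (q : ℂ) ^ j)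

theorem leadCoeff_ne_zero {q : ℝ} (hq0 : 0 < q) (n : ℕ) : leadCoeff q n ≠ 0 := by
  have : (q : ℂ) ≠ 0 := by exact_mod_cast hq0.ne'
  refine Finset.prod_ne_zero_iff.2 fun j _ => ?_
  simp [this]

theorem phi_eq {q : ℝ} (hq0 : 0 < q) (n : ℕ) (x : ℂ) :
    phi q n x = leadCoeff q n * ∏ j ∈ Finset.range n, (x - node q j) := by
  have : (q : ℂ) ≠ 0 := by exact_mod_cast hq0.ne'
  rw [phi, leadCoeff, ← Finset.prod_mul_distrib]
  refine Finset.prod_congr rfl fun j _ => ?_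
  simp only [node]
  push_cast
  field_simp
  ring

theorem node_injective {q : ℝ} (hq0 : 0 < q) (hq1 : q < 1) : Function.Injective (node q) := by
  refine (strictMono_nat_of_lt_succ fun n => ?_).injective
  have h1 : 0 < q ^ n := pow_pos hq0 n
  have h2 : q ^ n ≤ 1 := pow_le_one₀ hq0.le hq1.le
  have h3 : node q (n + 1) - node q n = (1 - q) * (1 - q ^ n * q ^ n * q) / (2 * q ^ n * q) := by
    simp only [node, pow_succ]
    field_simp
    ring
  have h4 : q ^ n * q ^ n * q < 1 := by
    have : q ^ n * q ^ n ≤ 1 := mul_le_one₀ h2 h1.le h2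
    nlinarith
  have : 0 < node q (n + 1) - node q n := by
    rw [h3]
    have := sub_pos.2 h4
    have := sub_pos.2 hq1
    positivity
  linarith

theorem IsExpansion.tendsto_at {q : ℝ} {a : ℕ → ℂ} {f : ℂ → ℂ} (h : IsExpansion q a f) (x : ℂ) :
    Tendsto (fun n => ∑ k ∈ Finset.range n, a k * phi q k x) atTop (𝓝 (f x)) :=
  (tendstoLocallyUniformlyOn_univ.2 h).tendsto_at (Set.mem_univ x)

/-- Every `phi q k` with k > j vanishes at the j-th node, so the series terminates there. -/
theorem IsExpansion.eq_sum_at_node {q : ℝ} (hq0 : 0 < q) {a : ℕ → ℂ} {f : ℂ → ℂ}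
    (h : IsExpansion q a f) (j : ℕ) :
    f (node q j) = ∑ k ∈ Finset.range (j + 1), a k * phi q k (node q j) := by
  have h1 := IsExpansion.tendsto_at h (node q j : ℂ)
  refine tendsto_nhds_unique h1 (tendsto_const_nhds.congr' ?_)
  filter_upwards [eventually_ge_atTop (j + 1)] with n hn
  refine Finset.sum_subset (Finset.range_mono hn) fun k _ hk => ?_
  rw [phi_eq hq0, Finset.prod_eq_zero (i := j), mul_zero, mul_zero]
  · simp at hk ⊢; omega
  · simp

theorem IsExpansion.unique {q : ℝ} (hq0 : 0 < q) (hq1 : q < 1) {a b : ℕ → ℂ} {f : ℂ → ℂ}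
    (ha : IsExpansion q a f) (hb : IsExpansion q b f) : a = b := by
  funext n
  induction n using Nat.strong_induction_on with
  | _ n ih =>
    have h := (ha.eq_sum_at_node hq0 n).symm.trans (hb.eq_sum_at_node hq0 n)
    rw [Finset.sum_range_succ, Finset.sum_range_succ,
      Finset.sum_congr rfl fun k hk => by rw [ih k (Finset.mem_range.1 hk)]] at h
    refine mul_right_cancel₀ ?_ (add_left_cancel h)
    rw [phi_eq hq0]
    refine mul_ne_zero (leadCoeff_ne_zero hq0 n) (Finset.prod_ne_zero_iff.2 fun j hj => ?_)
    rw [sub_ne_zero]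
    intro h'
    have := node_injective hq0 hq1 (Complex.ofReal_injective h')
    simp at hj; omega

/-! ### Existence of the expansion and decay of its coefficients -/

/-- Cauchy-type estimate on the circle R = exp(Ln): (4/R)^n contributes about exp(-Ln²), against
M(R) ≤ exp(Ln²/4). -/
theorem eventually_norm_divDiff_le {q : ℝ} (hq0 : 0 < q) (hq1 : q < 1) {f : ℂ → ℂ}
    (hf : Differentiable ℂ f) (hσ : logOrder f < 2) (C : ℝ) :
    ∀ᶠ n : ℕ in atTop, ∀ z : ℂ, ‖z‖ ≤ (8 / q) ^ n →
      ‖divDiff f (fun j => (node q j : ℂ)) n z‖ ≤ Real.exp (-C * (n : ℝ) ^ 2) := by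
  have hq8 : 1 < 8 / q := by rw [lt_div_iff₀ hq0]; linarith
  have hlog := Real.log_pos hq8
  -- The logarithm makes R ≥ (8/q)^n; the rest gives 3L/4 ≥ C + 2, where the 2 absorbs the powers of
  -- 4.
  set L : ℝ := 2 * |C| + 8 + Real.log (8 / q) with hL
  have hL0 : 8 < L := by have := abs_nonneg C; linarith
  have ht : Tendsto (fun n : ℕ => Real.exp (L * n)) atTop atTop :=
    Real.tendsto_exp_atTop.comp
      (tendsto_natCast_atTop_atTop.const_mul_atTop (by linarith : (0 : ℝ) < L))
  have hM := ht.eventually (eventually_maxModulus_le hσ (ε := 1 / (4 * L)) (by positivity))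
  filter_upwards [hM, eventually_ge_atTop 1] with n hn hn1 z hz
  have hn1' : (1 : ℝ) ≤ n := by exact_mod_cast hn1
  have hR : (8 / q) ^ n ≤ Real.exp (L * n) := by
    rw [mul_comm, Real.exp_nat_mul]
    refine pow_le_pow_left₀ (by positivity) ?_ n
    rw [← Real.log_le_iff_le_exp (by positivity)]
    have := abs_nonneg C
    linarith
  have h2q : 2 * (q ^ n)⁻¹ ≤ (8 / q) ^ n := by
    rw [div_pow, div_eq_mul_inv]
    refine mul_le_mul_of_nonneg_right ?_ (by positivity)
    calc (2 : ℝ) ≤ 8 ^ 1 := by norm_num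
      _ ≤ 8 ^ n := pow_le_pow_right₀ (by norm_num) hn1
  have h := norm_divDiff_le hf (fun j => (node q j : ℂ)) (Real.exp_pos (L * n))
    (B := Real.exp (1 / (4 * L) * Real.log (Real.exp (L * n)) ^ 2))
    (fun w hw => (norm_le_maxModulus hf.continuous w).trans (by rw [hw]; exact hn)) n
    (fun j hj => by
      rw [norm_node hq0]
      have := node_le hq0 hq1 j
      have := inv_pow_le hq0 hq1 hj.le
      linarith) (hz.trans hR)
  refine h.trans ?_
  have h4 : (4 : ℝ) ≤ Real.exp 2 := by
    have := Real.add_one_le_exp (1 : ℝ)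
    have h' : Real.exp 2 = Real.exp 1 * Real.exp 1 := by rw [← Real.exp_add]; norm_num
    nlinarith
  have h5 : 4 / Real.exp (L * n) ≤ Real.exp (2 - L * n) := by
    rw [Real.exp_sub]; gcongr
  refine (mul_le_mul_of_nonneg_right (pow_le_pow_left₀ (by positivity) h5 n)
    (Real.exp_pos _).le).trans ?_
  rw [← Real.exp_nat_mul, ← Real.exp_add, Real.log_exp, Real.exp_le_exp]
  have h6 : 1 / (4 * L) * (L * n) ^ 2 = L * (n : ℝ) ^ 2 / 4 := by field_simp
  rw [h6]
  have h7 : C ≤ L / 2 := by have := le_abs_self C; linarith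
  have h8 : (n : ℝ) ≤ (n : ℝ) ^ 2 := by nlinarith
  nlinarith [mul_le_mul_of_nonneg_right h7 (sq_nonneg (n : ℝ))]

/-- An entire function of logarithmic order less than two has an expansion, whose coefficients in
the basis of monic polynomials decay faster than every Gaussian. -/
theorem exists_isExpansion {q : ℝ} (hq0 : 0 < q) (hq1 : q < 1) {f : ℂ → ℂ}
    (hf : Differentiable ℂ f) (hσ : logOrder f < 2) :
    ∃ a : ℕ → ℂ, IsExpansion q a f ∧
      ∀ C : ℝ, ∀ᶠ n : ℕ in atTop, ‖a n * leadCoeff q n‖ ≤ Real.exp (-C * (n : ℝ) ^ 2) := by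
  set x : ℕ → ℂ := fun j => (node q j : ℂ) with hx
  refine ⟨fun n => divDiff f x n (x n) / leadCoeff q n, ?_, fun C => ?_⟩
  · rw [IsExpansion, tendstoLocallyUniformly_iff_forall_isCompact]
    intro S hS
    obtain ⟨ρ, hρ⟩ := hS.isBounded.exists_norm_le
    have hρ' : ∀ z ∈ S, ‖z‖ ≤ |ρ| := fun z hz => (hρ z hz).trans (le_abs_self ρ)
    set ℓ := Real.log ((|ρ| + 1) / q)
    have hpos : 0 < (|ρ| + 1) / q := by positivity
    have hz1 : ∀ᶠ n : ℕ in atTop, |ρ| ≤ (8 / q) ^ n := by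
      refine (tendsto_pow_atTop_atTop_of_one_lt ?_).eventually_ge_atTop _
      rw [lt_div_iff₀ hq0]; linarith
    rw [Metric.tendstoUniformlyOn_iff]
    intro ε hε
    have hlim : Tendsto (fun n : ℕ => Real.exp (-(n : ℝ))) atTop (𝓝 0) :=
      Real.tendsto_exp_neg_atTop_nhds_zero.comp tendsto_natCast_atTop_atTop
    -- The node product is at most exp(|ℓ|n²) on S, so decay rate |ℓ| + 1 leaves a remainder of at
    -- most exp(-n²) ≤ exp(-n).
    filter_upwards [eventually_norm_divDiff_le hq0 hq1 hf hσ (|ℓ| + 1), hz1,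
      hlim.eventually_lt_const hε, eventually_ge_atTop 1] with n hn hn1 hn2 hn3 z hz
    have hn3' : (1 : ℝ) ≤ n := by exact_mod_cast hn3
    have e1 : ∑ k ∈ Finset.range n, divDiff f x k (x k) / leadCoeff q k * phi q k z =
        ∑ k ∈ Finset.range n, divDiff f x k (x k) * ∏ j ∈ Finset.range k, (z - x j) := by
      refine Finset.sum_congr rfl fun k _ => ?_
      rw [phi_eq hq0, ← mul_assoc, div_mul_cancel₀ _ (leadCoeff_ne_zero hq0 k)]
    rw [e1, dist_eq_norm]
    nth_rw 1 [newton_formula f x n z]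
    rw [add_sub_cancel_left, norm_mul, norm_prod]
    have h1 : ∏ j ∈ Finset.range n, ‖z - x j‖ ≤ Real.exp (|ℓ| * (n : ℝ) ^ 2) := by
      have : ∀ j ∈ Finset.range n, ‖z - x j‖ ≤ ((|ρ| + 1) / q) ^ n := fun j hj => by
        have a1 := norm_sub_le z (x j)
        have a2 := norm_node hq0 j
        have a3 := node_le hq0 hq1 j
        have a4 := inv_pow_le hq0 hq1 (Finset.mem_range.1 hj).le
        have a5 := hρ' z hz
        have a6 : 1 ≤ (q ^ n)⁻¹ := by simpa using inv_pow_le hq0 hq1 (Nat.zero_le n)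
        have a7 : |ρ| + 1 ≤ (|ρ| + 1) ^ n := le_self_pow₀ (by linarith [abs_nonneg ρ]) (by omega)
        rw [div_pow, div_eq_mul_inv]
        have a8 : ‖x j‖ = node q j := a2
        nlinarith [abs_nonneg ρ]
      refine ((Finset.prod_le_prod (fun _ _ => norm_nonneg _) this).trans ?_).trans (Real.exp_le_exp.2
        (mul_le_mul_of_nonneg_right (le_abs_self ℓ) (sq_nonneg (n : ℝ))))
      rw [Finset.prod_const, Finset.card_range, ← pow_mul, ← Real.exp_log hpos, ← Real.exp_nat_mul, Real.exp_le_exp]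
      push_cast
      exact le_of_eq (by ring)
    have h2 := hn z ((hρ' z hz).trans hn1)
    refine lt_of_le_of_lt ?_ hn2
    refine (mul_le_mul h1 h2 (norm_nonneg _) (Real.exp_pos _).le).trans ?_
    rw [← Real.exp_add, Real.exp_le_exp]
    nlinarith
  · filter_upwards [eventually_norm_divDiff_le hq0 hq1 hf hσ C] with n hn
    rw [div_mul_cancel₀ _ (leadCoeff_ne_zero hq0 n)]
    refine hn _ ?_
    have a2 : ‖x n‖ = node q n := norm_node hq0 n
    rw [a2, div_pow, div_eq_mul_inv]
    refine (node_le hq0 hq1 n).trans (le_mul_of_one_le_left (by positivity) ?_)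
    exact one_le_pow₀ (by norm_num)

/-! ### Logarithmic measure and density -/

theorem logMeas_mono {E F : Set ℝ} (h : E ⊆ F) : logMeas E ≤ logMeas F :=
  lintegral_mono_set h

theorem logMeas_exp_image {B : Set ℝ} (hB : MeasurableSet B) :
    logMeas (Real.exp '' B) = volume B := by
  rw [logMeas, lintegral_image_eq_lintegral_abs_deriv_mul hB
    (fun x _ => (Real.hasDerivAt_exp x).hasDerivWithinAt) Real.exp_injective.injOn]
  have : ∀ x : ℝ, ENNReal.ofReal |Real.exp x| * ENNReal.ofReal (1 / Real.exp x) = 1 := fun x => by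
    rw [← ENNReal.ofReal_mul (abs_nonneg _), abs_of_pos (Real.exp_pos x),
      mul_one_div_cancel (Real.exp_pos x).ne', ENNReal.ofReal_one]
  simp only [this, lintegral_one, Measure.restrict_apply_univ]

/-- Displacing the points of `[s₀, ∞)` monotonically by `o(s)` leaves out a set of density zero. -/
theorem logDensity_eq_zero {P : ℝ → Prop} {d : ℝ → ℝ} (hd : Monotone d) (hd0 : ∀ s, 0 ≤ d s)
    {s₀ : ℝ} (hs₀ : 0 ≤ s₀) (hP : ∀ s, s₀ ≤ s → P (Real.exp (s + d s)))
    (hlim : Tendsto (fun s => d s / s) atTop (𝓝 0)) :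
    logDensity {r | 1 ≤ r ∧ ¬ P r} = 0 := by
  set h : ℝ → ℝ := fun s => s + d s with hh
  -- As d is increasing, h does not shrink distances, so the image of [s₀, τ] has measure at least τ
  -- - s₀.
  have hanti : AntilipschitzWith 1 h := by
    refine AntilipschitzWith.of_le_mul_dist fun s t => ?_
    rw [NNReal.coe_one, one_mul, Real.dist_eq, Real.dist_eq]
    rcases le_total s t with hst | hst
    · have := hd hst
      rw [abs_of_nonpos (by linarith), abs_of_nonpos (by simp only [hh]; linarith)]
      simp only [hh]; linarith
    · have := hd hst
      rw [abs_of_nonneg (by linarith), abs_of_nonneg (by simp only [hh]; linarith)]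
      simp only [hh]; linarith
  have hmono : Monotone h := monotone_id.add hd
  have key : ∀ τ, s₀ ≤ τ → logMeas ({r | 1 ≤ r ∧ ¬ P r} ∩ Set.Icc 1 (Real.exp τ)) ≤
      ENNReal.ofReal (d τ + s₀) := by
    intro τ hτ
    have hImeas : MeasurableSet (h '' Set.Icc s₀ τ) :=
      measurableSet_Icc.image_of_measurable_injOn hmono.measurable hanti.injective.injOn
    have hsub : h '' Set.Icc s₀ τ ⊆ Set.Icc 0 (h τ) := by
      rintro _ ⟨s, hs, rfl⟩
      exact ⟨add_nonneg (hs₀.trans hs.1) (hd0 s), hmono hs.2⟩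
    have hvol : ENNReal.ofReal (τ - s₀) ≤ volume (h '' Set.Icc s₀ τ) := by
      have := hanti.le_hausdorffMeasure_image zero_le_one (Set.Icc s₀ τ)
      rw [hausdorffMeasure_real] at this
      simpa using this
    -- Enlarging [0, τ] to [0, h τ] makes it contain the image; what is left has measure at most h τ
    -- - (τ - s₀) = d τ + s₀.
    have hE : {r | 1 ≤ r ∧ ¬ P r} ∩ Set.Icc 1 (Real.exp τ) ⊆
        Real.exp '' (Set.Icc 0 (h τ) \ h '' Set.Icc s₀ τ) := by
      rintro r ⟨⟨hr1, hrP⟩, -, hrτ⟩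
      have hr0 : 0 < r := by linarith
      refine ⟨Real.log r, ⟨⟨Real.log_nonneg hr1, ?_⟩, ?_⟩, Real.exp_log hr0⟩
      · have h1 := (Real.log_le_iff_le_exp hr0).2 hrτ
        have h2 := hd0 τ
        simp only [hh]; linarith
      · rintro ⟨s, hs, hsr⟩
        refine hrP ?_
        rw [← Real.exp_log hr0, ← hsr]
        exact hP s hs.1
    refine (logMeas_mono hE).trans ?_
    rw [logMeas_exp_image (measurableSet_Icc.diff hImeas),
      measure_sdiff hsub hImeas.nullMeasurableSet
        (measure_ne_top_of_subset hsub (by simp)), Real.volume_Icc]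
    refine (tsub_le_tsub_left hvol _).trans ?_
    rw [← ENNReal.ofReal_sub _ (by linarith)]
    refine ENNReal.ofReal_le_ofReal ?_
    simp only [hh]; linarith
  refine Tendsto.limsup_eq ?_
  have h0 : Tendsto (fun τ : ℝ => ENNReal.ofReal (d τ / τ + s₀ / τ)) atTop (𝓝 0) := by
    have := hlim.add (tendsto_const_nhds (x := s₀).div_atTop tendsto_id)
    simpa using ENNReal.tendsto_ofReal this
  refine tendsto_of_tendsto_of_tendsto_of_le_of_le' tendsto_const_nhds
    (h0.comp Real.tendsto_log_atTop) (Eventually.of_forall fun _ => zero_le) ?_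
  filter_upwards [Real.tendsto_log_atTop.eventually (eventually_ge_atTop s₀),
    eventually_gt_atTop 1] with r hr hr1
  have hlog := Real.log_pos hr1
  have := key _ hr
  rw [Real.exp_log (by linarith)] at this
  rw [Function.comp_apply, ← add_div, ENNReal.ofReal_div_of_pos hlog]
  exact ENNReal.div_le_div_right this _

/-! ### The central index -/

/-- The central index: for a nonnegative, nonzero sequence with faster than Gaussian decay, the
terms `c_n e^{K n² + n s}` are maximal at some `N s`, which is monotone and `o(s)`. -/
theorem exists_centralIndex {c : ℕ → ℝ} (hc : ∀ n, 0 ≤ c n) {m : ℕ} (hm : c m ≠ 0)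
    (hdecay : ∀ C : ℝ, ∀ᶠ n : ℕ in atTop, c n ≤ Real.exp (-C * (n : ℝ) ^ 2)) (K : ℝ) :
    ∃ N : ℝ → ℕ, Monotone N ∧ Tendsto (fun s => (N s : ℝ) / s) atTop (𝓝 0) ∧
      ∀ s n, c n * Real.exp (K * (n : ℝ) ^ 2 + n * s) ≤
        c (N s) * Real.exp (K * (N s : ℝ) ^ 2 + N s * s) := by
  have hm0 : 0 < c m := lt_of_le_of_ne (hc m) hm.symm
  have hex : ∀ s : ℝ, ∃ N : ℕ, ∀ n : ℕ, c n * Real.exp (K * (n : ℝ) ^ 2 + n * s) ≤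
      c N * Real.exp (K * (N : ℝ) ^ 2 + N * s) := by
    intro s
    set w : ℕ → ℝ := fun n => c n * Real.exp (K * (n : ℝ) ^ 2 + n * s) with hw
    have hw0 : ∀ n, 0 ≤ w n := fun n => mul_nonneg (hc n) (Real.exp_pos _).le
    have hlim : Tendsto w atTop (𝓝 0) := by
      have h1 : Tendsto (fun n : ℕ => Real.exp (-(n : ℝ))) atTop (𝓝 0) :=
        Real.tendsto_exp_neg_atTop_nhds_zero.comp tendsto_natCast_atTop_atTop
      refine squeeze_zero' (Eventually.of_forall hw0) ?_ h1
      filter_upwards [hdecay (K + |s| + 1), eventually_ge_atTop 1] with n hn hn1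
      have hn1' : (1 : ℝ) ≤ n := by exact_mod_cast hn1
      refine (mul_le_mul_of_nonneg_right hn (Real.exp_pos _).le).trans ?_
      rw [← Real.exp_add, Real.exp_le_exp]
      have h2 : (n : ℝ) ≤ (n : ℝ) ^ 2 := by nlinarith
      have h3 : (n : ℝ) * s ≤ (n : ℝ) ^ 2 * |s| :=
        (mul_le_mul_of_nonneg_left (le_abs_self s) (by linarith)).trans
          (mul_le_mul_of_nonneg_right h2 (abs_nonneg s))
      linarith
    have hwm : 0 < w m := mul_pos hm0 (Real.exp_pos _)
    obtain ⟨n₀, hn₀⟩ := eventually_atTop.1 (hlim.eventually_lt_const hwm)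
    obtain ⟨N, -, hN⟩ := Finset.exists_max_image (Finset.range (n₀ + m + 1)) w ⟨0, by simp⟩
    refine ⟨N, fun n => ?_⟩
    by_cases hn : n < n₀ + m + 1
    · exact hN n (by simpa using hn)
    · exact (hn₀ n (by omega)).le.trans (hN m (by simp))
  choose N hN using hex
  have hNpos : ∀ s, 0 < c (N s) := fun s => by
    have h1 : 0 < c m * Real.exp (K * (m : ℝ) ^ 2 + m * s) := mul_pos hm0 (Real.exp_pos _)
    exact pos_of_mul_pos_left (h1.trans_le (hN s m)) (Real.exp_pos _).le
  refine ⟨N, fun s t hst => ?_, ?_, hN⟩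
  -- Multiplying the maximality inequalities at s and t cancels the coefficients and leaves (N t - N
  -- s)(t - s) ≥ 0.
  · by_contra! hlt
    have hst' : s < t := lt_of_le_of_ne hst (by rintro rfl; exact lt_irrefl _ hlt)
    have h1 := mul_le_mul (hN s (N t)) (hN t (N s))
      (mul_nonneg (hc _) (Real.exp_pos _).le) (mul_nonneg (hc _) (Real.exp_pos _).le)
    have h2 : c (N t) * c (N s) * Real.exp (K * (N t : ℝ) ^ 2 + N t * s + (K * (N s : ℝ) ^ 2 + N s * t))
        ≤ c (N t) * c (N s) *
          Real.exp (K * (N s : ℝ) ^ 2 + N s * s + (K * (N t : ℝ) ^ 2 + N t * t)) := by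
      rw [Real.exp_add (_ + _), Real.exp_add (K * (N s : ℝ) ^ 2 + N s * s)]
      linarith
    have h3 := Real.exp_le_exp.1 (le_of_mul_le_mul_left h2 (mul_pos (hNpos t) (hNpos s)))
    have h4 : (N t : ℝ) < N s := by exact_mod_cast hlt
    nlinarith [mul_pos (sub_pos.2 hst') (sub_pos.2 h4)]
  -- Comparison with the fixed index m gives C N² ≤ N s + B once N > n₀; dividing by N gives slope
  -- 1/C, with C arbitrary.
  · have hbound : ∀ C : ℝ, 0 < C → ∃ D : ℝ, ∀ s, 0 ≤ s → (N s : ℝ) ≤ s / C + D := by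
      intro C hC
      obtain ⟨n₀, hn₀⟩ := eventually_atTop.1 (hdecay (K + C))
      set B := |Real.log (c m) + K * (m : ℝ) ^ 2|
      have hB : 0 ≤ B := abs_nonneg _
      refine ⟨B / C + n₀ + 1, fun s hs => ?_⟩
      by_cases hlt : N s < n₀ + 1
      · have : (N s : ℝ) ≤ n₀ + 1 := by exact_mod_cast hlt.le
        have : 0 ≤ s / C := by positivity
        have : 0 ≤ B / C := by positivity
        linarith
      · have h1 := hN s m
        rw [← Real.exp_log hm0] at h1
        rw [← Real.exp_add] at h1
        have h2 := h1.trans (mul_le_mul_of_nonneg_right (hn₀ (N s) (by omega)) (Real.exp_pos _).le)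
        rw [← Real.exp_add, Real.exp_le_exp] at h2
        have h3 : -B ≤ Real.log (c m) + K * (m : ℝ) ^ 2 := neg_abs_le _
        have h4 : 0 ≤ (m : ℝ) * s := by positivity
        have h5 : (1 : ℝ) ≤ N s := by exact_mod_cast (by omega : 1 ≤ N s)
        have h6 : C * N s ≤ s + B := by
          by_contra! hlt'
          nlinarith [mul_lt_mul_of_pos_right hlt' (by linarith : (0 : ℝ) < N s)]
        have h7 : (N s : ℝ) ≤ (s + B) / C := by rw [le_div_iff₀ hC]; linarith
        rw [add_div] at h7
        have : (0 : ℝ) ≤ n₀ := by positivity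
        linarith
    rw [Metric.tendsto_nhds]
    intro ε hε
    obtain ⟨D, hD⟩ := hbound (2 / ε) (by positivity)
    filter_upwards [eventually_gt_atTop 0, eventually_gt_atTop (2 * D / ε)] with s hs hsD
    rw [dist_zero_right, Real.norm_of_nonneg (by positivity), div_lt_iff₀ hs]
    have h1 := hD s hs.le
    rw [div_lt_iff₀ hε] at hsD
    have h2 : s / (2 / ε) = ε * s / 2 := by field_simp
    rw [h2] at h1
    linarith

/-! ### The comparison sequences -/

theorem abs_rpow_sub_rpow_le {δ : ℝ} (hδ0 : 0 < δ) (hδ1 : δ < 1) {s t : ℝ} (hs : 0 ≤ s)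
    (ht : 0 ≤ t) : |s ^ δ - t ^ δ| ≤ |s - t| ^ δ := by
  wlog h : t ≤ s generalizing s t
  · rw [abs_sub_comm, abs_sub_comm s]
    exact this ht hs (le_of_not_ge h)
  have h1 := Real.rpow_le_rpow ht h hδ0.le
  have h2 := Real.rpow_add_le_add_rpow (sub_nonneg.2 h) ht hδ0.le hδ1.le
  rw [sub_add_cancel] at h2
  rw [abs_of_nonneg (by linarith), abs_of_nonneg (by linarith)]
  linarith

/-- The right side is the exponential of ∫ (α(t) - α(N)) dt from N to n. Subadditivity of t^δ bounds
the integrand by |n - N|^δ/δ ≤ |n - N|/δ, the last step because distinct integers differ by at least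
1. -/
theorem le_alphaSeq_div_mul {δ : ℝ} (hδ0 : 0 < δ) (hδ1 : δ < 1) (n N : ℕ) :
    Real.exp (-((n : ℝ) - N) ^ 2 / δ) ≤
      alphaSeq δ n / alphaSeq δ N * rhoSeq δ N ^ ((n : ℤ) - (N : ℤ)) := by
  have hint : ∀ a b : ℝ, IntervalIntegrable (alphaFun δ) volume a b := fun a b =>
    (continuous_const.mul (Real.continuous_rpow_const hδ0.le)).intervalIntegrable a b
  have e : alphaSeq δ n / alphaSeq δ N * rhoSeq δ N ^ ((n : ℤ) - (N : ℤ)) =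
      Real.exp (∫ t in (N : ℝ)..n, (alphaFun δ t - alphaFun δ N)) := by
    rw [alphaSeq, alphaSeq, rhoSeq, ← Real.exp_sub, ← Real.rpow_intCast, ← Real.exp_mul, ← Real.exp_add,
      intervalIntegral.integral_interval_sub_left (hint _ _) (hint _ _),
      intervalIntegral.integral_sub (hint _ _) intervalIntegrable_const,
      intervalIntegral.integral_const]
    push_cast
    congr 1
    simp only [smul_eq_mul]
    ring
  rw [e, Real.exp_le_exp]
  rcases eq_or_ne n N with rfl | hne
  · simp
  have hm : 1 ≤ |(n : ℝ) - N| := by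
    have : (1 : ℤ) ≤ |(n : ℤ) - N| := Int.one_le_abs (by omega)
    exact_mod_cast this
  have hb := intervalIntegral.norm_integral_le_of_norm_le_const
    (f := fun t => alphaFun δ t - alphaFun δ N) (a := (N : ℝ)) (b := n)
    (C := |(n : ℝ) - N| / δ) (fun t ht => by
      have ht' := Set.uIoc_subset_uIcc ht
      have ht0 : 0 ≤ t := le_trans (by simp) ht'.1
      have h1 := abs_rpow_sub_rpow_le hδ0 hδ1 ht0 (Nat.cast_nonneg (α := ℝ) N)
      have h2 : |t - N| ≤ |(n : ℝ) - N| := Set.abs_sub_left_of_mem_uIcc ht'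
      have h3 : |t - N| ^ δ ≤ |(n : ℝ) - N| ^ (1 : ℝ) :=
        (Real.rpow_le_rpow (abs_nonneg _) h2 hδ0.le).trans
          (Real.rpow_le_rpow_of_exponent_le hm hδ1.le)
      rw [Real.rpow_one] at h3
      have h4 : alphaFun δ t - alphaFun δ N = -(t ^ δ - (N : ℝ) ^ δ) / δ := by
        simp only [alphaFun]; ring
      rw [h4, Real.norm_eq_abs, abs_div, abs_neg, abs_of_pos hδ0]
      exact div_le_div_of_nonneg_right (h1.trans h3) hδ0.le)
  have h5 : |(n : ℝ) - N| / δ * |(n : ℝ) - N| = ((n : ℝ) - N) ^ 2 / δ := by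
    rw [← sq_abs]; ring
  rw [h5] at hb
  have := (abs_le.1 hb).1
  rwa [neg_div]

/-! ### Node products and domination -/

/-- The products `∏_{j < n} |x - x_j|` behave like `|x|^n` up to a Gaussian factor, relative to an
index `N` with `x_N` small compared to `|x|`. -/
theorem prod_node_le {q : ℝ} (hq0 : 0 < q) (hq1 : q < 1) {x : ℂ} {τ : ℝ}
    (hx : ‖x‖ = Real.exp τ) {N : ℕ} (hN : 2 * (q ^ N)⁻¹ ≤ ‖x‖) (n : ℕ) :
    ∏ j ∈ Finset.range n, ‖x - node q j‖ ≤ (∏ j ∈ Finset.range N, ‖x - node q j‖) *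
      Real.exp (((n : ℝ) - N) * τ + Real.log (2 / q) * ((n : ℝ) - N) ^ 2) := by
  have hτ := Real.exp_pos τ
  have hlog2 : Real.log 2 ≤ Real.log (2 / q) :=
    Real.log_le_log (by norm_num) (by rw [le_div_iff₀ hq0]; linarith)
  rcases le_or_gt N n with h | h
  · obtain ⟨m, rfl⟩ := Nat.exists_eq_add_of_le h
    rw [← Finset.prod_range_mul_prod_Ico _ h]
    refine mul_le_mul_of_nonneg_left ?_ (Finset.prod_nonneg fun _ _ => norm_nonneg _)
    -- Each of the m added factors is at most |x| (2/q)^m, whence the Gaussian (2/q)^(m²).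
    have hfac : ∀ j ∈ Finset.Ico N (N + m), ‖x - node q j‖ ≤ Real.exp τ * (2 / q) ^ m := by
      intro j hj
      rw [Finset.mem_Ico] at hj
      have hm : m ≠ 0 := by omega
      have a1 := norm_sub_le x (node q j : ℂ)
      rw [norm_node hq0, hx] at a1
      have a2 := node_le hq0 hq1 j
      have a3 := inv_pow_le hq0 hq1 hj.2.le
      have a4 : (q ^ N)⁻¹ ≤ Real.exp τ := by
        rw [← hx]
        have : 0 < (q ^ N)⁻¹ := by positivity
        linarith
      have a5 : (q ^ (N + m))⁻¹ ≤ Real.exp τ * (q ^ m)⁻¹ := by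
        rw [pow_add, mul_inv]
        exact mul_le_mul_of_nonneg_right a4 (by positivity)
      have a6 : 1 ≤ (q ^ m)⁻¹ := by simpa using inv_pow_le hq0 hq1 (Nat.zero_le m)
      have a7 : (2 : ℝ) ≤ 2 ^ m := le_self_pow₀ (by norm_num) hm
      have a8 : 2 * (q ^ m)⁻¹ ≤ (2 / q) ^ m := by
        rw [div_pow, div_eq_mul_inv]
        exact mul_le_mul_of_nonneg_right a7 (by positivity)
      nlinarith [mul_le_mul_of_nonneg_left a8 hτ.le]
    refine (Finset.prod_le_prod (fun _ _ => norm_nonneg _) hfac).trans (le_of_eq ?_)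
    rw [Finset.prod_const, Nat.card_Ico, Nat.add_sub_cancel_left]
    nth_rw 1 [← Real.exp_log (by positivity : 0 < 2 / q)]
    rw [← Real.exp_nat_mul, ← Real.exp_add, ← Real.exp_nat_mul]
    push_cast
    congr 1
    ring
  · obtain ⟨m, rfl⟩ := Nat.exists_eq_add_of_le h.le
    have hm : (1 : ℝ) ≤ m := by exact_mod_cast (by omega : 1 ≤ m)
    rw [← Finset.prod_range_mul_prod_Ico _ h.le, mul_assoc]
    refine le_mul_of_one_le_right (Finset.prod_nonneg fun _ _ => norm_nonneg _) ?_
    -- Nodes before N are at most |x|/2, so each removed factor is at least |x|/2.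
    have hfac : ∀ j ∈ Finset.Ico n (n + m), Real.exp (τ - Real.log 2) ≤ ‖x - node q j‖ := by
      intro j hj
      rw [Finset.mem_Ico] at hj
      have a1 := norm_sub_norm_le x (node q j : ℂ)
      rw [norm_node hq0, hx] at a1
      rw [hx] at hN
      have a2 := node_le hq0 hq1 j
      have a3 := inv_pow_le hq0 hq1 hj.2.le
      rw [Real.exp_sub, Real.exp_log (by norm_num)]
      linarith
    have h1 := Finset.prod_le_prod (fun _ _ => (Real.exp_pos (τ - Real.log 2)).le) hfac
    rw [Finset.prod_const, Nat.card_Ico, Nat.add_sub_cancel_left, ← Real.exp_nat_mul] at h1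
    refine le_trans ?_ (mul_le_mul_of_nonneg_right h1 (Real.exp_pos _).le)
    rw [← Real.exp_add]
    refine Real.one_le_exp ?_
    push_cast
    have h2 : Real.log 2 * m ≤ Real.log (2 / q) * (m : ℝ) ^ 2 := by
      have := Real.log_pos (by norm_num : (1 : ℝ) < 2)
      have : (m : ℝ) ≤ (m : ℝ) ^ 2 := by nlinarith
      exact mul_le_mul hlog2 this (by linarith) (by linarith)
    nlinarith

theorem isDominatedAt_of_centralIndex {q : ℝ} (hq0 : 0 < q) (hq1 : q < 1) {δ : ℝ} (hδ0 : 0 < δ)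
    (hδ1 : δ < 1) (γ : ℝ) {a : ℕ → ℂ} {s : ℝ} (hs : Real.log 2 ≤ s) {K : ℝ}
    (hK : K = Real.log (2 / q) + 1 / δ) {N : ℕ}
    (hmax : ∀ n : ℕ, ‖a n * leadCoeff q n‖ * Real.exp (K * (n : ℝ) ^ 2 + n * s) ≤
      ‖a N * leadCoeff q N‖ * Real.exp (K * (N : ℝ) ^ 2 + N * s))
    {x : ℂ} (hx : ‖x‖ = Real.exp (s + 2 * K * N)) : IsDominatedAt q γ δ a x := by
  have hl1 : Real.log q⁻¹ ≤ Real.log (2 / q) :=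
    Real.log_le_log (by positivity) (by rw [div_eq_mul_inv]; linarith [inv_pos.2 hq0])
  have hl0 : 0 ≤ Real.log q⁻¹ := Real.log_nonneg ((one_le_inv₀ hq0).2 hq1.le)
  have hKq : Real.log q⁻¹ ≤ K := by
    have : 0 < 1 / δ := by positivity
    linarith
  -- The shift 2KN in ln|x| pays for q^(-N), and s ≥ ln 2 pays for the 2.
  have hN : 2 * (q ^ N)⁻¹ ≤ ‖x‖ := by
    rw [hx, Real.exp_add]
    refine mul_le_mul ?_ ?_ (by positivity) (Real.exp_pos _).le
    · exact (Real.log_le_iff_le_exp (by norm_num)).1 hs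
    · rw [← inv_pow, ← Real.exp_log (inv_pos.2 hq0), ← Real.exp_nat_mul, Real.exp_le_exp,
        mul_comm (N : ℝ)]
      exact mul_le_mul_of_nonneg_right (by linarith) (Nat.cast_nonneg N)
  have hterm : ∀ n, ‖a n * phi q n x‖ =
      ‖a n * leadCoeff q n‖ * ∏ j ∈ Finset.range n, ‖x - node q j‖ := fun n => by
    rw [phi_eq hq0, ← mul_assoc, norm_mul, norm_prod]
  have key : ∀ n, ‖a n * phi q n x‖ ≤ ‖a N * phi q N x‖ *
      (alphaSeq δ n / alphaSeq δ N * rhoSeq δ N ^ ((n : ℤ) - (N : ℤ))) := by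
    intro n
    refine le_trans ?_ (mul_le_mul_of_nonneg_left (le_alphaSeq_div_mul hδ0 hδ1 n N)
      (norm_nonneg _))
    have h1 : ‖a n * leadCoeff q n‖ ≤ ‖a N * leadCoeff q N‖ *
        Real.exp (K * (N : ℝ) ^ 2 + N * s - (K * (n : ℝ) ^ 2 + n * s)) := by
      rw [Real.exp_sub, ← mul_div_assoc, le_div_iff₀ (Real.exp_pos _)]
      exact hmax n
    rw [hterm, hterm]
    refine (mul_le_mul h1 (prod_node_le hq0 hq1 hx hN n)
      (Finset.prod_nonneg fun _ _ => norm_nonneg _) (by positivity)).trans (le_of_eq ?_)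
    -- The exponents add up to -K(n-N)² + ln(2/q)(n-N)² = -(n-N)²/δ: the shift 2KN completes the
    -- square.
    rw [mul_mul_mul_comm, ← Real.exp_add]
    congr 2
    rw [hK]
    ring
  refine ⟨N, fun n => ⟨fun _ => ?_, fun _ => ?_⟩⟩
  · rw [mul_assoc]
    exact key n
  · refine (key n).trans ?_
    have h1 : 0 ≤ eps q γ n N := Finset.sum_nonneg fun k _ => by positivity
    have h2 : 0 ≤ alphaSeq δ n / alphaSeq δ N * rhoSeq δ N ^ ((n : ℤ) - (N : ℤ)) :=
      (Real.exp_pos _).le.trans (le_alphaSeq_div_mul hδ0 hδ1 n N)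
    rw [mul_assoc (_ * _)]
    exact mul_le_mul_of_nonneg_right
      (le_mul_of_one_le_right (norm_nonneg _) (by linarith)) h2

end AskeyWilson

/-! ### Conclusion -/

theorem theorem5p3 (q : ℝ) (hq0 : 0 < q) (hq1 : q < 1)
    (f : ℂ → ℂ) (hf : Differentiable ℂ f) (hfc : ¬ ∃ c : ℂ, ∀ x : ℂ, f x = c)
    (hσ : AskeyWilson.logOrder f < 2)
    (γ : ℝ) (hγ1 : 1 < γ)
    -- `γ < 1 / (σ - 1)`, where the right-hand side is `∞` if `σ = 1`
    (hγ : ENNReal.ofReal γ < 1 / (AskeyWilson.logOrder f - 1).toENNReal)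
    (δ : ℝ) (hδ0 : 0 < δ) (hδ1 : δ < 1) :
    (∃! a : ℕ → ℂ, AskeyWilson.IsExpansion q a f) ∧
    ∀ a : ℕ → ℂ, AskeyWilson.IsExpansion q a f →
      AskeyWilson.logDensity (AskeyWilson.exceptionalSet q γ δ a) = 0 ∧
      AskeyWilson.logDensity (AskeyWilson.exceptionalSetNeg q γ δ a) = 0 := by
  obtain ⟨a, ha, hdecay⟩ := AskeyWilson.exists_isExpansion hq0 hq1 hf hσ
  refine ⟨⟨a, ha, fun b hb => hb.unique hq0 hq1 ha⟩, fun b hb => ?_⟩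
  obtain rfl := ha.unique hq0 hq1 hb
  -- If all coefficients vanished, f would be the constant 0; a nonzero one is needed for a central
  -- index.
  have hne : ∃ m, a m ≠ 0 := by
    by_contra! h
    refine hfc ⟨0, fun x => tendsto_nhds_unique (ha.tendsto_at x) ?_⟩
    simp [h]
  obtain ⟨m, hm⟩ := hne
  set K : ℝ := Real.log (2 / q) + 1 / δ with hK
  have hK0 : 0 ≤ K := by
    have : 0 ≤ Real.log (2 / q) := Real.log_nonneg (by rw [le_div_iff₀ hq0]; linarith)
    positivity
  obtain ⟨N, hmono, hlim, hmax⟩ := AskeyWilson.exists_centralIndex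
    (c := fun n => ‖a n * AskeyWilson.leadCoeff q n‖) (fun n => norm_nonneg _) (m := m)
    (norm_ne_zero_iff.2 (mul_ne_zero hm (AskeyWilson.leadCoeff_ne_zero hq0 m))) hdecay K
  have hd : Monotone fun s => 2 * K * (N s : ℝ) := fun s t hst =>
    mul_le_mul_of_nonneg_left (Nat.cast_le.2 (hmono hst)) (by positivity)
  have hd0 : ∀ s, 0 ≤ 2 * K * (N s : ℝ) := fun s => by positivity
  have hdlim : Tendsto (fun s => 2 * K * (N s : ℝ) / s) atTop (𝓝 0) := by
    simpa [mul_div_assoc] using hlim.const_mul (2 * K)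
  have hlog2 : 0 ≤ Real.log 2 := Real.log_nonneg (by norm_num)
  constructor
  · refine AskeyWilson.logDensity_eq_zero hd hd0 hlog2 (fun s hs => ⟨Real.exp_pos _, ?_⟩) hdlim
    refine AskeyWilson.isDominatedAt_of_centralIndex hq0 hq1 hδ0 hδ1 γ hs hK (hmax s) ?_
    rw [Complex.norm_real, Real.norm_of_nonneg (Real.exp_pos _).le]
  · refine AskeyWilson.logDensity_eq_zero hd hd0 hlog2 (fun s hs => ⟨Real.exp_pos _, ?_⟩) hdlim
    refine AskeyWilson.isDominatedAt_of_centralIndex hq0 hq1 hδ0 hδ1 γ hs hK (hmax s) ?_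
    rw [norm_neg, Complex.norm_real, Real.norm_of_nonneg (Real.exp_pos _).le]
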